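/- Let $n,b\ge 1$ be integers. A $(1,b)$-parking function of length $n$ is a sequence $\pi=(\pi_1,\dots,\pi_n)$ of positive integers whose weakly increasing rearrangement $\lambda_1\le\cdots\le\lambda_n$ satisfies $\lambda_i\le 1+(i-1)b$ for all $1\le i\le n$. For such $\pi$ and an integer $x$ let $B_\pi(x)=\{j\in[n]:\pi_j=x\}$, and put $\mathrm{lel}(\pi)=|B_\pi(\pi_1)|$ and $\mathrm{ones}(\pi)=|B_\pi(1)|$. The preference partition of $\pi$ is the set partition of $[n]$ into the nonempty sets $B_\pi(x)$, and the reduced preference partition of $\pi$ is obtained from it by merging $B_\pi(1)$ and $B_\pi(\pi_1)$ into the single block $B_\pi(1)\cup B_\pi(\pi_1)$ (so it equals the preference partition if $\pi_1=1$). Corollary 8.1. Fix a set partition $\mathcal P$ of $[n]$. Then $\mathrm{lel}$ and $\mathrm{ones}$ have a symmetric joint distribution over the $(1,b)$-parking functions of length $n$ whose reduced preference partition is $\mathcal P$; that is, for all integers $s,t\ge 0$, the number of such $\pi$ with $\mathrm{lel}(\pi)=s$ and $\mathrm{ones}(\pi)=t$ equals the number of such $\pi$ with $\mathrm{lel}(\pi)=t$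 and $\mathrm{ones}(\pi)=s$. -/

import Mathlib

namespace ParkingFunction

/-- A `u`-parking function of length `n`: a sequence of positive integers whose weakly increasing
rearrangement is bounded termwise by `u`. (Positions are numbered `0, …, n - 1`, values start
at `1`.) -/
def IsUParking {n : ℕ} (u : Fin n → ℕ) (π : Fin n → ℕ) : Prop :=
  (∀ i, 1 ≤ π i) ∧ ∀ i, (π ∘ Tuple.sort π) i ≤ u i

/-- The set `PF(a, b, n)` of `(a, b)`-parking functions of length `n`: the `u`-parking functions
for `u = (a, a + b, …, a + (n - 1) b)`. -/
def PF (a b n : ℕ) : Set (Fin n → ℕ) :=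
  {π | IsUParking (fun i : Fin n => a + (i : ℕ) * b) π}

/-- `PF(a, b, n)` is finite, so its subsets can be counted by `Set.ncard`. -/
theorem finite_PF (a b n : ℕ) : (PF a b n).Finite := by
  refine (Set.finite_Iic (fun _ : Fin n => a + n * b)).subset ?_
  intro π hπ i
  have h := hπ.2 ((Tuple.sort π).symm i)
  simp only [Function.comp_apply, Equiv.apply_symm_apply] at h
  refine h.trans ?_
  exact Nat.add_le_add_left (Nat.mul_le_mul_right b ((Tuple.sort π).symm i).isLt.le) a

/-- The set of cars that prefer spot `x`. -/
def block {n : ℕ} (π : Fin n → ℕ) (x : ℕ) : Finset (Fin n) :=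
  Finset.univ.filter (fun j => π j = x)

/-- The leading elements statistic: the number of cars with the same preference as the first
car. -/
def lel {n : ℕ} [NeZero n] (π : Fin n → ℕ) : ℕ := (block π (π 0)).card

/-- The number of cars that prefer spot `1`. -/
def ones {n : ℕ} (π : Fin n → ℕ) : ℕ := (block π 1).card

/-- The preference partition: the collection of the nonempty blocks. -/
def preferencePartition {n : ℕ} (π : Fin n → ℕ) : Finset (Finset (Fin n)) :=
  Finset.univ.image (fun j => block π (π j))

/-- The reduced preference partition: in the preference partition, the block of spot `1` and the
block of the spot preferred by the first car are replaced by their union. -/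
def reducedPreferencePartition {n : ℕ} [NeZero n] (π : Fin n → ℕ) : Finset (Finset (Fin n)) :=
  insert (block π 1 ∪ block π (π 0)) (preferencePartition π \ {block π 1, block π (π 0)})

end ParkingFunction

namespace ParkingFunction

open Finset

/-! If `s = t` there is nothing to prove. Otherwise `π 0 ≠ 1`, so the blocks of spot `1` and of `π
0` are disjoint with union the part of `P` containing `0`; with `m` its size, `s + t = m`. Fix the
block `T` of spot `1`, of size `t`, inside that part minus `0`. What remains of `π` is an injective
labelling of the parts by `n * b` later spots, taken cyclically. By the cycle lemma exactly `b * t`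
of the `n * b` rotations of a labelling park (`card_rotations_parks`), so a fraction `t / n` of all
labellings does, whatever `T` is (`card_block_one_eq`). Summing over `T` gives a count proportional
to `(m - 1).choose t * t`, which is symmetric under `t ↔ m - t`. -/

/-! ### Cycle lemma and rotations -/

/-- The cycle lemma: a walk with increments at most `1` that gains `r > 0` in each period of
length `L` has exactly `r` strict records per period. -/
theorem card_records {F : ℕ → ℤ} {L r : ℕ} (hL : 0 < L) (hr : 0 < r)
    (hper : ∀ x, F (x + L) = F x + r) (hstep : ∀ x, F (x + 1) ≤ F x + 1) :
    #{c ∈ range L | ∀ x < L, F (c + x) < F (c + L)} = r := by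
  have hne : (range L).Nonempty := nonempty_range_iff.2 hL.ne'
  let M : ℕ → ℤ := fun c => (range L).sup' hne fun x => F (c + x)
  have le_M : ∀ c x, x < L → F (c + x) ≤ M c := fun c x hx =>
    le_sup' (fun x => F (c + x)) (mem_range.2 hx)
  have M_le : ∀ c v, (∀ x < L, F (c + x) ≤ v) → M c ≤ v := fun c v h =>
    sup'_le _ _ fun x hx => h x (mem_range.1 hx)
  -- Sliding the window by one raises its maximum by 1 at a strict record, otherwise by 0: the value
  -- dropped, `F c`, is below `F (c + L)`. The sum over a period telescopes.
  have hM : ∀ c, M (c + 1) - M c = if ∀ x < L, F (c + x) < F (c + L) then 1 else 0 := by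
    intro c
    have hlast : F (c + L) ≤ M (c + 1) := by
      have := le_M (c + 1) (L - 1) (by omega)
      rwa [show c + 1 + (L - 1) = c + L by omega] at this
    have hmono : M c ≤ M (c + 1) := by
      refine M_le _ _ fun x hx => ?_
      rcases x with _ | x
      · have := hper c
        simp only [add_zero]
        omega
      · have := le_M (c + 1) x (by omega)
        rwa [show c + 1 + x = c + (x + 1) by omega] at this
    have hmax : ∀ v, M c ≤ v → F (c + L) ≤ v → M (c + 1) ≤ v := by
      intro v h1 h2
      refine M_le _ _ fun x hx => ?_
      rw [show c + 1 + x = c + (x + 1) by omega]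
      rcases Nat.lt_or_ge (x + 1) L with h | h
      · exact (le_M c _ h).trans h1
      · rwa [show x + 1 = L by omega]
    have hup : F (c + L) ≤ M c + 1 := by
      have h1 := le_M c (L - 1) (by omega)
      have h2 := hstep (c + (L - 1))
      rw [show c + (L - 1) + 1 = c + L by omega] at h2
      omega
    split_ifs with h
    · have h1 : M c ≤ F (c + L) - 1 := M_le _ _ fun x hx => by have := h x hx; omega
      have := hmax (F (c + L)) (by omega) le_rfl
      omega
    · push Not at h
      obtain ⟨x, hx, h⟩ := h
      have := hmax (M c) le_rfl (h.trans (le_M c x hx))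
      omega
  have htot : M L = M 0 + r := by
    apply le_antisymm
    · refine M_le _ _ fun x hx => ?_
      have := le_M 0 x hx
      rw [add_comm L x, hper]
      rw [zero_add] at this
      omega
    · have : M 0 ≤ M L - r := M_le _ _ fun x hx => by
        have := le_M L x hx
        rw [add_comm L x, hper] at this
        rw [zero_add]
        omega
      omega
  have hsum := sum_range_sub M L
  rw [sum_congr rfl fun c _ => hM c, sum_boole, htot] at hsum
  omega

/-- The counting form of the parking condition for cars of which `t` prefer the first spot, while
the cars in `S` prefer the spots `g` among the `L` later ones. -/
def Parks {ι : Type*} {L : ℕ} (b t : ℕ) (S : Finset ι) (g : ι → ZMod L) : Prop :=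
  ∀ x < L, x < b * (t + #{j ∈ S | (g j).val < x})

theorem sum_range_natCast_eq {L : ℕ} [NeZero L] (a : ZMod L) {x : ℕ} (hx : x ≤ L) :
    (∑ y ∈ range x, if a = (y : ZMod L) then 1 else 0) = if a.val < x then 1 else 0 := by
  have h : ∀ y ∈ range x, (if a = (y : ZMod L) then 1 else 0) = if a.val = y then 1 else 0 := by
    intro y hy
    have hy' : y < L := (mem_range.1 hy).trans_le hx
    congr 1
    apply propext
    constructor
    · rintro rfl
      exact ZMod.val_cast_of_lt hy'
    · rintro rfl
      simp
  rw [sum_congr rfl h]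
  simp

open Classical in
/-- Exactly `b * t` of the `L` rotations of a preference function satisfy the parking condition. -/
theorem card_rotations_parks {ι : Type*} {L b t : ℕ} [NeZero L] (S : Finset ι) (g : ι → ZMod L)
    (hL : b * (t + #S) = L) :
    #{c : ZMod L | Parks b t S fun j => g j - c} = b * t := by
  have hL0 : 0 < L := NeZero.pos L
  rcases Nat.eq_zero_or_pos (b * t) with h0 | hpos
  · rw [h0, card_eq_zero, filter_eq_empty_iff]
    intro c _ h
    have := h 0 hL0
    simp [h0] at this
  -- Each spot contributes `+1` and each car preferring it `-b`. A period gains `L - b * #S = b *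
  -- t`, so the rotation by `c` parks iff `c + L` is a strict record.
  let F : ℕ → ℤ := fun x => ∑ y ∈ range x, (1 - (b : ℤ) * #{j ∈ S | g j = (y : ZMod L)})
  have hF : ∀ c x, x ≤ L →
      F (c + x) = F c + (x - (b : ℤ) * #{j ∈ S | (g j - c).val < x}) := by
    intro c x hx
    have hcard : ∑ y ∈ range x, #{j ∈ S | g j = ((c + y : ℕ) : ZMod L)} =
        #{j ∈ S | (g j - c).val < x} := by
      simp only [card_filter]
      rw [sum_comm]
      refine sum_congr rfl fun j _ => ?_
      rw [← sum_range_natCast_eq _ hx]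
      refine sum_congr rfl fun y _ => ?_
      simp only [Nat.cast_add, sub_eq_iff_eq_add']
    simp only [F, sum_range_add, ← hcard]
    simp [sum_sub_distrib, mul_sum]
  have hper : ∀ x, F (x + L) = F x + ((b * t : ℕ) : ℤ) := by
    intro x
    rw [hF x L le_rfl, filter_true_of_mem fun j _ => ZMod.val_lt _, ← hL]
    push_cast
    ring
  have hstep : ∀ x, F (x + 1) ≤ F x + 1 := by
    intro x
    simp only [F, sum_range_succ]
    have : 0 ≤ (b : ℤ) * #{j ∈ S | g j = (x : ZMod L)} := by positivity
    omega
  rw [← card_records hL0 hpos hper hstep]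
  symm
  refine card_bij (fun c _ => (c : ZMod L)) ?_ ?_ ?_
  · intro c hc
    simp only [mem_filter, mem_univ, true_and] at hc ⊢
    intro x hx
    beta_reduce
    have h := hc.2 x hx
    rw [hper, hF c x hx.le] at h
    rw [mul_add]
    omega
  · intro c hc d hd h
    simp only [mem_filter, mem_range] at hc hd
    have := congrArg ZMod.val h
    rwa [ZMod.val_cast_of_lt hc.1, ZMod.val_cast_of_lt hd.1] at this
  · intro c hc
    simp only [mem_filter, mem_univ, true_and] at hc
    refine ⟨c.val, ?_, by simp⟩
    simp only [mem_filter, mem_range]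
    refine ⟨ZMod.val_lt c, fun x hx => ?_⟩
    have h := hc x hx
    rw [hper, hF _ x hx.le]
    rw [mul_add] at h
    rw [ZMod.natCast_zmod_val]
    push_cast at *
    omega

open Classical in
/-- The number of injective labellings of the blocks of `q` that satisfy the parking condition. -/
theorem card_embeddings_parks {ι κ : Type*} [Fintype κ] {L b t : ℕ} [NeZero L] (S : Finset ι)
    (q : ι → κ) (hL : b * (t + #S) = L) :
    L * #{h : κ ↪ ZMod L | Parks b t S (h ∘ q)} = b * t * Fintype.card (κ ↪ ZMod L) := by
  have hrot : ∀ c : ZMod L, #{h : κ ↪ ZMod L | Parks b t S fun j => h (q j) - c} =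
      #{h : κ ↪ ZMod L | Parks b t S (h ∘ q)} := by
    intro c
    refine card_bij (fun h _ => h.trans (Equiv.subRight c).toEmbedding) ?_ ?_ ?_
    · intro h hh
      simpa [Function.comp_def] using hh
    · intro h _ h' _ e
      ext x
      simpa using congrArg (fun f : κ ↪ ZMod L => f x) e
    · intro h hh
      refine ⟨h.trans (Equiv.addRight c).toEmbedding, ?_, ?_⟩
      · simpa [Function.comp_def] using hh
      · ext x
        simp
  have h := sum_card_bipartiteAbove_eq_sum_card_bipartiteBelow (s := (univ : Finset (ZMod L)))
    (t := (univ : Finset (κ ↪ ZMod L))) fun c h => Parks b t S fun j => h (q j) - c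
  simp only [bipartiteAbove, bipartiteBelow, hrot] at h
  rw [sum_congr rfl fun (h : κ ↪ ZMod L) _ =>
    card_rotations_parks S (fun j => h (q j)) hL] at h
  simp only [sum_const, card_univ, ZMod.card, smul_eq_mul] at h
  rw [h, mul_comm]

/-! ### Counting form of parking; merged partitions -/

theorem mem_block {n : ℕ} {π : Fin n → ℕ} {x : ℕ} {j : Fin n} : j ∈ block π x ↔ π j = x := by
  simp [block]

theorem mem_PF_one_iff {n b : ℕ} (hb : 1 ≤ b) (π : Fin n → ℕ) :
    π ∈ PF 1 b n ↔ (∀ i, 1 ≤ π i) ∧ ∀ x < n * b, x < b * #{j | π j ≤ x + 1} := by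
  have hsort : ∀ (i : Fin n) (v : ℕ), (π ∘ Tuple.sort π) i ≤ v ↔ (i : ℕ) < #{j | π j ≤ v} := by
    intro i v
    rw [← Tuple.lt_card_le_iff_apply_le_of_monotone (Tuple.monotone_sort π)]
    have : #{j | (π ∘ Tuple.sort π) j ≤ v} = #{j | π j ≤ v} :=
      card_equiv (Tuple.sort π) (by simp)
    rw [this]
  simp only [PF, IsUParking, Set.mem_ofPred_eq, hsort]
  refine and_congr_right fun _ => ⟨fun h x hx => ?_, fun h i => ?_⟩
  -- The sharpest instances are the multiples of `b`; any other `x` follows from the index `x / b`.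
  · have hi : x / b < n := Nat.div_lt_of_lt_mul (by rwa [mul_comm])
    have h1 : x / b < #{j | π j ≤ 1 + x / b * b} := h ⟨x / b, hi⟩
    have h2 : #{j | π j ≤ 1 + x / b * b} ≤ #{j | π j ≤ x + 1} := by
      refine card_le_card fun j => ?_
      simp only [mem_filter, mem_univ, true_and]
      have := Nat.div_mul_le_self x b
      omega
    calc x < b * (x / b + 1) := Nat.lt_mul_div_succ x hb
      _ ≤ _ := Nat.mul_le_mul_left b (h1.trans_le h2)
  · have := h (i * b) (Nat.mul_lt_mul_of_pos_right i.isLt hb)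
    rw [mul_comm, add_comm] at this
    rw [mul_comm (i : ℕ) b]
    exact Nat.lt_of_mul_lt_mul_left this

/-- The preferences after moving the cars that prefer spot `1` to the spot of the first car. -/
def merged {n : ℕ} [NeZero n] (π : Fin n → ℕ) (j : Fin n) : ℕ := if π j = 1 then π 0 else π j

theorem block_merged_of_merged {n : ℕ} [NeZero n] (π : Fin n → ℕ) {j : Fin n}
    (hj : merged π j = π 0) : block (merged π) (merged π j) = block π 1 ∪ block π (π 0) := by
  ext k
  simp only [hj, mem_block, mem_union]
  unfold merged
  split_ifs with h <;> simp [h]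

theorem block_merged_of_ne {n : ℕ} [NeZero n] (π : Fin n → ℕ) {j : Fin n} (hj : merged π j ≠ π 0) :
    block (merged π) (merged π j) = block π (π j) := by
  have h1 : π j ≠ 1 := fun h => hj (by simp [merged, h])
  have h2 : merged π j = π j := by simp [merged, h1]
  rw [h2] at hj ⊢
  ext k
  simp only [mem_block]
  unfold merged
  split_ifs with h
  · exact ⟨fun e => absurd e.symm hj, fun e => absurd (e.symm.trans h) h1⟩
  · rfl

theorem block_eq_block_iff {n : ℕ} {π : Fin n → ℕ} {j : Fin n} {x : ℕ} :
    block π (π j) = block π x ↔ π j = x := by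
  refine ⟨fun h => ?_, fun h => by rw [h]⟩
  have : j ∈ block π (π j) := by simp [block]
  rw [h] at this
  simpa [block] using this

/-- Turns the reduced partition into an ordinary level-set partition, so that prescribing it means
labelling the parts injectively. -/
theorem reducedPreferencePartition_eq {n : ℕ} [NeZero n] (π : Fin n → ℕ) :
    reducedPreferencePartition π = preferencePartition (merged π) := by
  have h0 : merged π 0 = π 0 := by
    unfold merged; split_ifs <;> rfl
  have hiff : ∀ j, merged π j = π 0 ↔ π j = 1 ∨ π j = π 0 := by
    intro j
    unfold merged
    split_ifs with h <;> simp [h]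
  ext B
  simp only [reducedPreferencePartition, preferencePartition, mem_insert, mem_sdiff, mem_image,
    mem_univ, true_and, mem_singleton]
  constructor
  · rintro (rfl | ⟨⟨j, rfl⟩, hj⟩)
    · exact ⟨0, block_merged_of_merged π h0⟩
    · refine ⟨j, block_merged_of_ne π ?_⟩
      rwa [block_eq_block_iff, block_eq_block_iff, ← hiff] at hj
  · rintro ⟨j, rfl⟩
    by_cases hj : merged π j = π 0
    · exact Or.inl (block_merged_of_merged π hj)
    · refine Or.inr ?_
      rw [block_merged_of_ne π hj]
      refine ⟨⟨j, rfl⟩, ?_⟩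
      rwa [block_eq_block_iff, block_eq_block_iff, ← hiff]

theorem preferencePartition_eq_parts_iff {n : ℕ} (r : Fin n → ℕ)
    (P : Finpartition (univ : Finset (Fin n))) :
    preferencePartition r = P.parts ↔ ∀ j k, r k = r j ↔ P.part k = P.part j := by
  constructor
  · intro h j k
    have hj : block r (r j) = P.part j := by
      refine (P.part_eq_of_mem ?_ (by simp [block])).symm
      rw [← h]
      exact mem_image_of_mem _ (mem_univ j)
    rw [← P.mem_part_iff_part_eq_part (mem_univ _) (mem_univ _), ← hj]
    simp [block]
  · intro h
    have hblock : ∀ j, block r (r j) = P.part j := by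
      intro j
      ext k
      rw [P.mem_part_iff_part_eq_part (mem_univ _) (mem_univ _), ← h]
      simp [block]
    ext B
    simp only [preferencePartition, mem_image, mem_univ, true_and, hblock]
    constructor
    · rintro ⟨j, rfl⟩
      exact P.part_mem.2 (mem_univ j)
    · intro hB
      obtain ⟨j, hj⟩ := P.nonempty_of_mem_parts hB
      exact ⟨j, P.part_eq_of_mem hB hj⟩

/-! ### Parking functions as labellings of parts -/

/-- The part of `P` that contains a given car. -/
def toPart {n : ℕ} (P : Finpartition (univ : Finset (Fin n))) (j : Fin n) : P.parts :=
  ⟨P.part j, P.part_mem.2 (mem_univ j)⟩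

theorem toPart_surjective {n : ℕ} (P : Finpartition (univ : Finset (Fin n))) :
    Function.Surjective (toPart P) := by
  rintro ⟨B, hB⟩
  obtain ⟨j, hj⟩ := P.nonempty_of_mem_parts hB
  exact ⟨j, Subtype.ext (P.part_eq_of_mem hB hj)⟩

/-- The preferences in which the cars of `T` prefer spot `1` and the other cars prefer the spots
assigned by `h` to their parts. -/
def placement {n L : ℕ} (P : Finpartition (univ : Finset (Fin n))) (T : Finset (Fin n))
    (h : P.parts ↪ ZMod L) (j : Fin n) : ℕ :=
  -- The shift by 2 sends residue 0 to spot `2`, keeping spot `1` for `T`.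
  if j ∈ T then 1 else (h (toPart P j)).val + 2

theorem placement_mem_PF_iff {n b : ℕ} (hb : 1 ≤ b) (P : Finpartition (univ : Finset (Fin n)))
    (T : Finset (Fin n)) (h : P.parts ↪ ZMod (n * b)) :
    placement P T h ∈ PF 1 b n ↔ Parks b #T Tᶜ (h ∘ toPart P) := by
  rw [mem_PF_one_iff hb, and_iff_right]
  · refine forall₂_congr fun x _ => ?_
    have : #{j | placement P T h j ≤ x + 1} =
        #T + #{j ∈ Tᶜ | ((h ∘ toPart P) j).val < x} := by
      rw [← card_union_of_disjoint]
      · congr 1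
        ext j
        have hj : placement P T h j ≤ x + 1 ↔ j ∈ T ∨ j ∉ T ∧ (h (toPart P j)).val < x := by
          unfold placement
          split_ifs with hj
          · simp [hj]
          · simp only [hj, not_false_eq_true, true_and, false_or]
            omega
        simpa using hj
      · exact disjoint_compl_right.mono_right (filter_subset _ _)
    rw [this]
  · intro j
    unfold placement
    split_ifs <;> omega

theorem block_placement_one {n L : ℕ} (P : Finpartition (univ : Finset (Fin n)))
    (T : Finset (Fin n)) (h : P.parts ↪ ZMod L) : block (placement P T h) 1 = T := by
  ext j
  by_cases hj : j ∈ T <;> simp [block, placement, hj]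

theorem merged_placement {n L : ℕ} [NeZero n] (P : Finpartition (univ : Finset (Fin n)))
    {T : Finset (Fin n)} (hT : T ⊆ (P.part 0).erase 0) (h : P.parts ↪ ZMod L) (j : Fin n) :
    merged (placement P T h) j = (h (toPart P j)).val + 2 := by
  have h0 : (0 : Fin n) ∉ T := fun h => by simpa using hT h
  by_cases hj : j ∈ T
  · have : toPart P j = toPart P 0 := Subtype.ext <|
      (P.mem_part_iff_part_eq_part (mem_univ _) (mem_univ _)).1 (mem_of_mem_erase (hT hj))
    simp [merged, placement, hj, h0, this]
  · simp [merged, placement, hj]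

/-- The `(1, b)`-parking functions with reduced preference partition `P` in which the first car
does not prefer spot `1`. -/
def nontrivialPF {n : ℕ} [NeZero n] (b : ℕ) (P : Finpartition (univ : Finset (Fin n))) :
    Set (Fin n → ℕ) :=
  {π | π ∈ PF 1 b n ∧ reducedPreferencePartition π = P.parts ∧ π 0 ≠ 1}

theorem block_one_subset {n b : ℕ} [NeZero n] {P : Finpartition (univ : Finset (Fin n))}
    {π : Fin n → ℕ} (hπ : π ∈ nontrivialPF b P) : block π 1 ⊆ (P.part 0).erase 0 := by
  obtain ⟨-, h, h0⟩ := hπ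
  rw [reducedPreferencePartition_eq, preferencePartition_eq_parts_iff] at h
  intro j hj
  have hj : π j = 1 := by simpa [block] using hj
  rw [mem_erase, P.mem_part_iff_part_eq_part (mem_univ _) (mem_univ _), ← h]
  refine ⟨?_, by simp [merged, hj]⟩
  rintro rfl
  exact h0 hj

theorem lel_add_ones {n b : ℕ} [NeZero n] {P : Finpartition (univ : Finset (Fin n))}
    {π : Fin n → ℕ} (hπ : π ∈ nontrivialPF b P) : lel π + ones π = #(P.part 0) := by
  obtain ⟨-, h, h0⟩ := hπ
  rw [reducedPreferencePartition_eq, preferencePartition_eq_parts_iff] at h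
  rw [lel, ones, ← card_union_of_disjoint]
  · congr 1
    ext j
    rw [P.mem_part_iff_part_eq_part (mem_univ _) (mem_univ _), ← h]
    simp only [block, merged, mem_union, mem_filter, mem_univ, true_and]
    split_ifs <;> simp_all
  · rw [disjoint_left]
    intro j hj hj'
    simp only [block, mem_filter, mem_univ, true_and] at hj hj'
    exact h0 (hj.symm.trans hj')

theorem placement_mem_nontrivialPF_iff {n b : ℕ} [NeZero n] (hb : 1 ≤ b)
    (P : Finpartition (univ : Finset (Fin n))) {T : Finset (Fin n)}
    (hT : T ⊆ (P.part 0).erase 0) (h : P.parts ↪ ZMod (n * b)) :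
    placement P T h ∈ nontrivialPF b P ↔ Parks b #T Tᶜ (h ∘ toPart P) := by
  have : NeZero (n * b) := ⟨Nat.mul_ne_zero (NeZero.ne n) (by omega)⟩
  have h0 : (0 : Fin n) ∉ T := fun h => by simpa using hT h
  rw [← placement_mem_PF_iff hb]
  refine and_iff_left ⟨?_, by simp [placement, h0]⟩
  rw [reducedPreferencePartition_eq, preferencePartition_eq_parts_iff]
  intro j k
  rw [merged_placement P hT, merged_placement P hT, Nat.add_right_cancel_iff,
    (ZMod.val_injective _).eq_iff, h.injective.eq_iff, toPart, toPart, Subtype.mk.injEq]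

theorem exists_placement_eq {n b : ℕ} [NeZero n]
    {P : Finpartition (univ : Finset (Fin n))} {π : Fin n → ℕ} (hπ : π ∈ nontrivialPF b P) :
    ∃ h : P.parts ↪ ZMod (n * b), placement P (block π 1) h = π := by
  obtain ⟨hPF, h, h0⟩ := hπ
  rw [reducedPreferencePartition_eq, preferencePartition_eq_parts_iff] at h
  have hbound : ∀ j, 1 ≤ π j ∧ π j < n * b + 2 := by
    intro j
    refine ⟨hPF.1 j, ?_⟩
    have hj := hPF.2 ((Tuple.sort π).symm j)
    simp only [Function.comp_apply, Equiv.apply_symm_apply] at hj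
    have := Nat.mul_le_mul_right b ((Tuple.sort π).symm j).isLt.le
    omega
  -- The lower bound uses `π 0 ≠ 1`: merging leaves no car at spot `1`.
  have hmerged : ∀ j, 2 ≤ merged π j ∧ merged π j - 2 < n * b := by
    intro j
    have h1 := hbound j
    have h2 := hbound 0
    unfold merged
    split_ifs <;> omega
  have hval : ∀ j, ((merged π j - 2 : ℕ) : ZMod (n * b)).val = merged π j - 2 := fun j =>
    ZMod.val_cast_of_lt (hmerged j).2
  let rep := Function.surjInv (toPart_surjective P)
  have hrep : ∀ B, toPart P (rep B) = B := Function.surjInv_eq (toPart_surjective P)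
  refine ⟨⟨fun B => ((merged π (rep B) - 2 : ℕ) : ZMod (n * b)), fun B C hBC => ?_⟩, ?_⟩
  · have e := congrArg ZMod.val hBC
    simp only [hval] at e
    have e' : merged π (rep B) = merged π (rep C) := by
      have := hmerged (rep B)
      have := hmerged (rep C)
      omega
    rw [← hrep B, ← hrep C]
    exact Subtype.ext (show P.part (rep B) = P.part (rep C) from (h _ _).1 e')
  · funext j
    simp only [placement, block, mem_filter, mem_univ, true_and]
    split_ifs with hj
    · exact hj.symm
    · have e : merged π (rep (toPart P j)) = merged π j :=
        (h _ _).2 (congrArg Subtype.val (hrep (toPart P j)))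
      change ((merged π (rep (toPart P j)) - 2 : ℕ) : ZMod (n * b)).val + 2 = π j
      rw [hval, Nat.sub_add_cancel (hmerged _).1, e]
      simp [merged, hj]

theorem placement_injective {n L : ℕ} [NeZero n] [NeZero L]
    (P : Finpartition (univ : Finset (Fin n))) {T : Finset (Fin n)}
    (hT : T ⊆ (P.part 0).erase 0) : Function.Injective (placement (L := L) P T) := by
  intro h h' e
  ext B
  obtain ⟨j, rfl⟩ := toPart_surjective P B
  apply ZMod.val_injective
  have := congrArg (fun π => merged π j) e
  simpa [merged_placement P hT] using this

/-! ### Enumeration and symmetry -/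

open Classical in
/-- The number of parking functions in `nontrivialPF b P` with a given block of spot `1`. -/
theorem card_block_one_eq {n b : ℕ} [NeZero n] (hb : 1 ≤ b)
    (P : Finpartition (univ : Finset (Fin n))) {T : Finset (Fin n)}
    (hT : T ⊆ (P.part 0).erase 0) :
    n * {π ∈ nontrivialPF b P | block π 1 = T}.ncard =
      #T * Nat.card (P.parts ↪ ZMod (n * b)) := by
  have : NeZero (n * b) := ⟨Nat.mul_ne_zero (NeZero.ne n) (by omega)⟩
  have hset : {π ∈ nontrivialPF b P | block π 1 = T} =
      placement P T '' {h : P.parts ↪ ZMod (n * b) | Parks b #T Tᶜ (h ∘ toPart P)} := by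
    ext π
    constructor
    · rintro ⟨hπ, rfl⟩
      obtain ⟨h, hh⟩ := exists_placement_eq hπ
      exact ⟨h, (placement_mem_nontrivialPF_iff hb P hT h).1 (by rwa [hh]), hh⟩
    · rintro ⟨h, hh, rfl⟩
      exact ⟨(placement_mem_nontrivialPF_iff hb P hT h).2 hh, block_placement_one P T h⟩
  have hcard := card_embeddings_parks (L := n * b) (b := b) (t := #T) Tᶜ (toPart P)
    (by rw [card_add_card_compl, Fintype.card_fin, mul_comm])
  rw [hset, Set.ncard_image_of_injective _ (placement_injective P hT), Set.ncard_eq_toFinset_card',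
    Set.toFinset_ofPred, Nat.card_eq_fintype_card]
  apply Nat.eq_of_mul_eq_mul_left hb
  linarith

theorem finite_nontrivialPF {n : ℕ} [NeZero n] (b : ℕ)
    (P : Finpartition (univ : Finset (Fin n))) : (nontrivialPF b P).Finite :=
  (finite_PF 1 b n).subset fun _ h => h.1

theorem card_ones_eq {n b : ℕ} [NeZero n] (hb : 1 ≤ b)
    (P : Finpartition (univ : Finset (Fin n))) (t : ℕ) :
    n * {π ∈ nontrivialPF b P | ones π = t}.ncard =
      (#(P.part 0) - 1).choose t * (t * Nat.card (P.parts ↪ ZMod (n * b))) := by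
  have hfin := finite_nontrivialPF b P
  have hncard : ∀ (p : (Fin n → ℕ) → Prop) [DecidablePred p],
      {π ∈ nontrivialPF b P | p π}.ncard = #{π ∈ hfin.toFinset | p π} := by
    intro p _
    rw [← Set.ncard_coe_finset]
    congr 1
    ext π
    simp
  have hmaps : ∀ π ∈ ({π ∈ hfin.toFinset | ones π = t} : Finset (Fin n → ℕ)),
      block π 1 ∈ powersetCard t ((P.part 0).erase 0) := by
    intro π hπ
    simp only [mem_filter, Set.Finite.mem_toFinset] at hπ
    exact mem_powersetCard.2 ⟨block_one_subset hπ.1, hπ.2⟩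
  have hfiber : ∀ T ∈ powersetCard t ((P.part 0).erase 0),
      n * #{π ∈ ({π ∈ hfin.toFinset | ones π = t} : Finset (Fin n → ℕ)) | block π 1 = T} =
        t * Nat.card (P.parts ↪ ZMod (n * b)) := by
    intro T hT
    obtain ⟨hsub, rfl⟩ := mem_powersetCard.1 hT
    rw [← card_block_one_eq hb P hsub, hncard, filter_filter]
    congr 2
    refine filter_congr fun π _ => ⟨fun h => h.2, fun h => ⟨?_, h⟩⟩
    rw [ones, h]
  rw [hncard, card_eq_sum_card_fiberwise hmaps, mul_sum, sum_congr rfl hfiber, sum_const,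
    card_powersetCard, card_erase_of_mem (P.mem_part (mem_univ _)), smul_eq_mul]

/-- For `s, t ≥ 1` both sides are `(m - 1)! / ((s - 1)! (t - 1)!)`; if `s` or `t` is 0, both vanish.
-/
theorem choose_mul_symm {m s t : ℕ} (h : s + t = m) :
    (m - 1).choose t * t = (m - 1).choose s * s := by
  rcases s with _ | s
  · rcases t with _ | t
    · rfl
    · subst h
      simp
  · rw [Nat.choose_succ_right_eq, show m - 1 = s + t by omega, Nat.choose_symm_add,
      Nat.add_sub_cancel_left]

/-- Unequal statistics force `π 0 ≠ 1`, and then `lel` is determined by `ones`. -/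
theorem setOf_lel_ones_eq {n : ℕ} [NeZero n] (b : ℕ) (P : Finpartition (univ : Finset (Fin n)))
    {s t : ℕ} (hst : s ≠ t) :
    {π ∈ PF 1 b n | reducedPreferencePartition π = P.parts ∧ lel π = s ∧ ones π = t} =
      {π ∈ nontrivialPF b P | ones π = t ∧ s + t = #(P.part 0)} := by
  ext π
  constructor
  · rintro ⟨hPF, hP, rfl, rfl⟩
    have hπ : π ∈ nontrivialPF b P := by
      refine ⟨hPF, hP, fun h => hst ?_⟩
      rw [lel, h, ones]
    exact ⟨hπ, rfl, lel_add_ones hπ⟩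
  · rintro ⟨hπ, rfl, h⟩
    have := lel_add_ones hπ
    exact ⟨hπ.1, hπ.2.1, by omega, rfl⟩

end ParkingFunction

theorem corollary8p1 (n b : ℕ) [NeZero n] (hb : 1 ≤ b)
    (P : Finpartition (Finset.univ : Finset (Fin n))) (s t : ℕ) :
    {π ∈ ParkingFunction.PF 1 b n |
        ParkingFunction.reducedPreferencePartition π = P.parts ∧
          ParkingFunction.lel π = s ∧ ParkingFunction.ones π = t}.ncard =
      {π ∈ ParkingFunction.PF 1 b n |
        ParkingFunction.reducedPreferencePartition π = P.parts ∧
          ParkingFunction.lel π = t ∧ ParkingFunction.ones π = s}.ncard := by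
  rcases eq_or_ne s t with rfl | hst
  · rfl
  rw [ParkingFunction.setOf_lel_ones_eq b P hst, ParkingFunction.setOf_lel_ones_eq b P hst.symm]
  by_cases hm : s + t = (P.part 0).card
  · simp only [hm, (add_comm t s).trans hm, and_true]
    apply Nat.eq_of_mul_eq_mul_left (NeZero.pos n)
    rw [ParkingFunction.card_ones_eq hb, ParkingFunction.card_ones_eq hb, ← mul_assoc,
      ← mul_assoc, ParkingFunction.choose_mul_symm hm]
  · simp [hm, (add_comm t s) ▸ hm]
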